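/- Let $\mathcal H$ be an infinite-dimensional complex Hilbert space, let ${\bf A}=(A_1,\dots,A_m)$ be an $m$-tuple of bounded self-adjoint operators on $\mathcal H$, and let $p_0,p,q$ be positive integers. Notation. For an $m$-tuple ${\bf T}=(T_1,\dots,T_m)$ of bounded operators on a Hilbert space $\mathcal L$ put $$W({\bf T})=\{(\langle T_1x,x\rangle,\dots,\langle T_mx,x\rangle): x\in\mathcal L,\ \|x\|=1\}\subseteq\mathbb C^m,$$ $$W(q:{\bf T})=\{(X^*T_1X,\dots,X^*T_mX): X:\mathbb C^q\to\mathcal L \text{ linear},\ X^*X=I_q\}\subseteq {\bf M}_q^m,$$ $$\Lambda_{p,q}({\bf T})=\{(B_1,\dots,B_m)\in{\bf M}_q^m:\ \text{there is a linear } X:\mathbb C^p\otimes\mathbb C^q\to\mathcal L \text{ with } X^*X=I_{pq} \text{ and } X^*T_jX=I_p\otimes B_j \text{ for } j=1,\dots,m\},$$ where ${\bf M}_q$ is the space of complex $q\times q$ matrices. Write ${\bf cl}$ for closure, ${\bf A}+{\bf F}=(A_1+F_1,\dots,A_m+F_m)$ and $Y^*{\bf A}Y=(Y^*A_1Y,\dots,Y^*A_mY)$.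 Let $$W_{ess}({\bf A})=\bigcap_{{\bf F}}{\bf cl}\,W({\bf A}+{\bf F}),\qquad W_{ess}(q:{\bf A})=\bigcap_{{\bf F}}{\bf cl}\,W(q:{\bf A}+{\bf F}),\qquad \Lambda^{ess}_{p,q}({\bf A})=\bigcap_{{\bf F}}{\bf cl}\,\Lambda_{p,q}({\bf A}+{\bf F}),$$ the intersections running over all $m$-tuples ${\bf F}=(F_1,\dots,F_m)$ of bounded finite rank operators on $\mathcal H$. A star-center of a subset $S$ of a real vector space is a point $c\in S$ such that $tc+(1-t)s\in S$ for all $s\in S$ and $0\le t\le1$; let $\tilde S_{r,q}({\bf A})$ be the set of star-centers of ${\bf cl}(\Lambda_{r,q}({\bf A}))$. Let $\mathcal V^\perp$ be the set of all linear isometries $Y:\mathcal K^\perp\to\mathcal H$ whose range has finite codimension in $\mathcal H$, where $\mathcal K$ runs over the subspaces of $\mathcal H$ of finite dimension at least $1$. Theorem. The set $$\Lambda^{ess}_{p,q}({\bf A})=W_{ess}(q:{\bf A})$$ is a compact convex set containing $(a_1I_q,\dots,a_mI_q)$ for all $(a_1,\dots,a_m)\in W_{ess}({\bf A})$. Consequently,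 $\Lambda^{ess}_{p,q}({\bf A})$ is independent of the choice of the positive integer $p$. Moreover, $$\Lambda^{ess}_{p,q}({\bf A})=\bigcap_{r\ge1}\tilde S_{r,q}({\bf A})=\bigcap_{r\ge1}{\bf cl}(\Lambda_{r,q}({\bf A}))=\bigcap\{{\bf cl}(\Lambda_{p_0,q}(Y^*{\bf A}Y)): Y\in\mathcal V^\perp\}.$$ -/

import Mathlib

open scoped Kronecker

namespace MatricialRange

section

variable {H : Type*} [NormedAddCommGroup H] [InnerProductSpace ℂ H] [CompleteSpace H]
variable {E : Type*} [NormedAddCommGroup E] [InnerProductSpace ℂ E] [CompleteSpace E]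
variable {m : ℕ}

/-- The compression `X* A X` of a bounded operator `A` by a linear isometry `X`
(a linear isometry between Hilbert spaces is the same as an operator with `X* X = I`). -/
noncomputable def compression (X : E →ₗᵢ[ℂ] H) (A : H →L[ℂ] H) : E →L[ℂ] E :=
  ContinuousLinearMap.adjoint X.toContinuousLinearMap ∘L A ∘L X.toContinuousLinearMap

/-- The joint numerical range
`W(A) = {(⟨A₁ x, x⟩, …, ⟨A_m x, x⟩) : ‖x‖ = 1}`. -/
def jointNumericalRange (A : Fin m → (H →L[ℂ] H)) : Set (Fin m → ℂ) :=
  {b | ∃ x : H, ‖x‖ = 1 ∧ ∀ j, b j = inner ℂ x (A j x)}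

/-- The joint `q`-matricial range: all `m`-tuples `(X* A₁ X, …, X* A_m X)` of `q × q` matrices,
where `X` is an isometry from a `q`-dimensional space (with a fixed orthonormal basis). -/
def jointQMatricialRange (q : ℕ) (A : Fin m → (H →L[ℂ] H)) :
    Set (Fin m → Matrix (Fin q) (Fin q) ℂ) :=
  {B | ∃ X : EuclideanSpace ℂ (Fin q) →ₗᵢ[ℂ] H,
    ∀ j, compression X (A j) = Matrix.toEuclideanCLM (𝕜 := ℂ) (B j)}

/-- The joint `(p,q)`-matricial range: all `m`-tuples `(B₁, …, B_m)` of `q × q` matrices such that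
`X* A_j X = I_p ⊗ B_j` for all `j`, for one isometry `X` from a `pq`-dimensional space. -/
def jointMatricialRange (p q : ℕ) (A : Fin m → (H →L[ℂ] H)) :
    Set (Fin m → Matrix (Fin q) (Fin q) ℂ) :=
  {B | ∃ X : EuclideanSpace ℂ (Fin p × Fin q) →ₗᵢ[ℂ] H,
    ∀ j, compression X (A j) =
      Matrix.toEuclideanCLM (𝕜 := ℂ) ((1 : Matrix (Fin p) (Fin p) ℂ) ⊗ₖ B j)}

/-- `F` is an operator of finite rank. -/
def IsFiniteRank (F : H →L[ℂ] H) : Prop :=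
  FiniteDimensional ℂ (LinearMap.range (F : H →ₗ[ℂ] H))

/-- The joint essential numerical range: the intersection of the closures of `W(A + F)` over all
`m`-tuples `F` of finite rank operators. -/
def essNumericalRange (A : Fin m → (H →L[ℂ] H)) : Set (Fin m → ℂ) :=
  ⋂ (F : Fin m → (H →L[ℂ] H)) (_ : ∀ j, IsFiniteRank (F j)),
    closure (jointNumericalRange (A + F))

/-- The joint essential `q`-matricial range. -/
def essQMatricialRange (q : ℕ) (A : Fin m → (H →L[ℂ] H)) :
    Set (Fin m → Matrix (Fin q) (Fin q) ℂ) :=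
  ⋂ (F : Fin m → (H →L[ℂ] H)) (_ : ∀ j, IsFiniteRank (F j)),
    closure (jointQMatricialRange q (A + F))

/-- The joint essential `(p,q)`-matricial range. -/
def essMatricialRange (p q : ℕ) (A : Fin m → (H →L[ℂ] H)) :
    Set (Fin m → Matrix (Fin q) (Fin q) ℂ) :=
  ⋂ (F : Fin m → (H →L[ℂ] H)) (_ : ∀ j, IsFiniteRank (F j)),
    closure (jointMatricialRange p q (A + F))

/-- The set of star-centers of `S`: points `c ∈ S` with `t c + (1 - t) s ∈ S` for all `s ∈ S`
and `0 ≤ t ≤ 1`. -/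
def starCenters {V : Type*} [AddCommGroup V] [Module ℝ V] (S : Set V) : Set V :=
  {c | c ∈ S ∧ StarConvex ℝ c S}

/-- An isometry `Y : Kᗮ → H`, where `K` is a subspace of `H` of finite dimension `r ≥ 1`
(`finrank` is `0` in infinite dimension), is of finite codimension
if its range has finite codimension in `H`. -/
def IsFiniteCodimIsometry (K : Submodule ℂ H) (Y : Kᗮ →ₗᵢ[ℂ] H) : Prop :=
  1 ≤ Module.finrank ℂ K ∧ FiniteDimensional ℂ (LinearMap.range Y.toLinearMap)ᗮ

end

end MatricialRange

open MatricialRange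

/-! ### Block systems and their weighted orthogonal sums -/

namespace MatricialRange

section

variable {H : Type*} [NormedAddCommGroup H] [InnerProductSpace ℂ H]
variable {ι ι' κ κ' : Type*} {m : ℕ}

/-! Every set in the theorem equals `cofiniteRange Unit A`: the tuples that can be approximated, for
each finite-dimensional `K`, by compressions of `A` to subspaces of `Kᗮ`. A given finite system is
separated from every system in `Kᗮ` once `K` is large enough. Separated systems can be added with
coefficients `√w`, and this averages their compressions with weights `w`.

Averaging yields convexity and the star-center property (`cofiniteRange_smul_add_smul_mem`). With
Radon's theorem it also yields amplification: among many separated systems close to `B`, two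
disjoint groups share a convex combination `N`, so `N` is realized twice, orthogonally
(`cofiniteRange_subset_bool_prod`). Iterating shows that the number of copies is irrelevant.

Two arguments lead back into `cofiniteRange`. If `B` is realized with many copies, a dimension count
finds a copy inside `Kᗮ` (`blockRange_subset_of_finrank_lt`). If `B` survives all finite rank
perturbations, one perturbation makes `A` scalar on `K`, and the scalar part is then reproduced
inside `Kᗮ` (`mem_cofiniteRange_of_finiteRank`). -/

/-- The family `x` compresses `T` to the block matrix `I ⊗ M`. -/
def BlockValued [DecidableEq ι] (T : H →L[ℂ] H) (x : ι → κ → H) (M : Matrix κ κ ℂ) : Prop :=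
  ∀ a i b k, inner ℂ (x a i) (T (x b k)) = if a = b then M i k else 0

/-- The family `x` is orthonormal and compresses every `A j` to `I ⊗ B j`. -/
structure IsSystem [DecidableEq ι] [DecidableEq κ] (A : Fin m → (H →L[ℂ] H)) (x : ι → κ → H)
    (B : Fin m → Matrix κ κ ℂ) : Prop where
  one : BlockValued (1 : H →L[ℂ] H) x 1
  val : ∀ j, BlockValued (A j) x (B j)

/-- The tuples `B` such that `I ⊗ B` is a compression of `A` to a subspace of `Kᗮ`. -/
def blockRange (ι : Type*) {κ : Type*} [DecidableEq ι] [DecidableEq κ] (A : Fin m → (H →L[ℂ] H))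
    (K : Submodule ℂ H) : Set (Fin m → Matrix κ κ ℂ) :=
  {B | ∃ x : ι → κ → H, (∀ a i, x a i ∈ Kᗮ) ∧ IsSystem A x B}

/-- The tuples in the closure of all block ranges over subspaces of finite codimension. -/
def cofiniteRange (ι : Type*) {κ : Type*} [DecidableEq ι] [DecidableEq κ]
    (A : Fin m → (H →L[ℂ] H)) : Set (Fin m → Matrix κ κ ℂ) :=
  {B | ∀ K : Submodule ℂ H, FiniteDimensional ℂ K → B ∈ closure (blockRange ι A K)}

/-- The families `x` and `y` are orthogonal with respect to the form of `T`, in both orders. -/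
def Separated (T : H →L[ℂ] H) (x : ι → κ → H) (y : ι' → κ' → H) : Prop :=
  ∀ a i b k, inner ℂ (x a i) (T (y b k)) = 0 ∧ inner ℂ (y b k) (T (x a i)) = 0

lemma mem_closure_iff_entries {S : Set (Fin m → Matrix κ κ ℂ)} [Fintype κ]
    {B : Fin m → Matrix κ κ ℂ} :
    B ∈ closure S ↔ ∀ ε > 0, ∃ B' ∈ S, ∀ j i k, ‖B' j i k - B j i k‖ < ε := by
  have h : ∀ (ε : ℝ), 0 < ε → ∀ C C' : Fin m → κ → κ → ℂ,
      dist C C' < ε ↔ ∀ j i k, ‖C' j i k - C j i k‖ < ε := fun ε hε C C' => by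
    rw [dist_comm]
    simp only [dist_pi_lt_iff hε]
    simp only [dist_eq_norm]
  exact (Metric.mem_closure_iff (α := Fin m → κ → κ → ℂ) (s := S) (a := B)).trans
    (forall₂_congr fun ε hε => exists_congr fun B' => and_congr Iff.rfl (h ε hε B B'))

section

variable [DecidableEq ι] [DecidableEq ι'] [DecidableEq κ]

omit [DecidableEq κ] in
lemma BlockValued.comp_injective {T : H →L[ℂ] H} {x : ι → κ → H} {M : Matrix κ κ ℂ}
    (h : BlockValued T x M) {e : ι' → ι} (he : e.Injective) :
    BlockValued T (fun a => x (e a)) M := by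
  intro a i b k
  rw [h]
  simp [he.eq_iff]

lemma IsSystem.comp_injective {A : Fin m → (H →L[ℂ] H)} {x : ι → κ → H}
    {B : Fin m → Matrix κ κ ℂ} (h : IsSystem A x B) {e : ι' → ι} (he : e.Injective) :
    IsSystem A (fun a => x (e a)) B :=
  ⟨h.one.comp_injective he, fun j => (h.val j).comp_injective he⟩

lemma blockRange_subset_of_injective {A : Fin m → (H →L[ℂ] H)} {K : Submodule ℂ H}
    {e : ι' → ι} (he : e.Injective) :
    blockRange ι A K ⊆ blockRange (κ := κ) ι' A K := by
  rintro B ⟨x, hxK, hx⟩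
  exact ⟨fun a => x (e a), fun a i => hxK _ _, hx.comp_injective he⟩

lemma cofiniteRange_subset_of_injective {A : Fin m → (H →L[ℂ] H)}
    {e : ι' → ι} (he : e.Injective) :
    cofiniteRange ι A ⊆ cofiniteRange (κ := κ) ι' A :=
  fun _ hB K hK => closure_mono (blockRange_subset_of_injective he) (hB K hK)

lemma blockRange_antitone {A : Fin m → (H →L[ℂ] H)} {K L : Submodule ℂ H} (h : K ≤ L) :
    blockRange ι A L ⊆ blockRange (κ := κ) ι A K := by
  rintro B ⟨x, hxK, hx⟩
  exact ⟨x, fun a i => Submodule.orthogonal_le h (hxK a i), hx⟩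

lemma IsSystem.norm_eq_one {A : Fin m → (H →L[ℂ] H)} {x : ι → κ → H}
    {B : Fin m → Matrix κ κ ℂ} (h : IsSystem A x B) (a : ι) (i : κ) : ‖x a i‖ = 1 := by
  have := h.one a i a i
  simp only [one_apply_eq_self, if_true, Matrix.one_apply_eq] at this
  have h2 : ‖x a i‖ ^ 2 = 1 := by
    rw [← inner_self_eq_norm_sq (𝕜 := ℂ), this]
    simp
  exact (pow_eq_one_iff_of_nonneg (norm_nonneg _) two_ne_zero).1 h2

omit [DecidableEq κ] in
-- Separation kills the cross terms, leaving `∑ g, w c g * w c' g * M g`. The disjoint supports make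
-- this vanish for `c ≠ c'`; for `c = c'` the squared weights average the `M g` to `N`.
lemma BlockValued.combine {G C : Type*} [Fintype G] [DecidableEq G] [DecidableEq C]
    {T : H →L[ℂ] H} {x : G → ι → κ → H}
    {M : G → Matrix κ κ ℂ} {N : Matrix κ κ ℂ} {w : C → G → ℝ}
    (hx : ∀ g, BlockValued T (x g) (M g))
    (hsep : ∀ g h, g ≠ h → Separated T (x g) (x h))
    (hdisj : ∀ c c', c ≠ c' → ∀ g, w c g * w c' g = 0)
    (hN : ∀ c, ∑ g, (w c g ^ 2) • M g = N) :
    BlockValued T (fun (ca : C × ι) i => ∑ g, (w ca.1 g : ℂ) • x g ca.2 i) N := by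
  rintro ⟨c, a⟩ i ⟨c', b⟩ k
  change inner ℂ (∑ g, (w c g : ℂ) • x g a i) (T (∑ g, (w c' g : ℂ) • x g b k)) = _
  rw [map_sum, sum_inner]
  simp_rw [inner_sum, map_smul, inner_smul_left, inner_smul_right, Complex.conj_ofReal]
  have h1 : ∀ g h, (w c g : ℂ) * ((w c' h : ℂ) * inner ℂ (x g a i) (T (x h b k))) =
      if g = h then ((w c g * w c' g : ℝ) : ℂ) * (if a = b then M g i k else 0) else 0 := by
    intro g h
    split_ifs with hgh hab
    · subst hgh; rw [hx]; simp [hab, mul_assoc]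
    · subst hgh; rw [hx]; simp [hab]
    · rw [(hsep g h hgh a i b k).1]; simp
  simp_rw [h1, Finset.sum_ite_eq, Finset.mem_univ, if_true]
  by_cases hc : c = c'
  · subst hc
    by_cases hab : a = b
    · subst hab
      rw [← hN c]
      simp [Matrix.sum_apply, pow_two, Complex.real_smul]
    · simp [hab]
  · simp [hc, hdisj c c' hc]

lemma IsSystem.combine {G C : Type*} [Fintype G] [DecidableEq G] [DecidableEq C]
    {A : Fin m → (H →L[ℂ] H)} {x : G → ι → κ → H}
    {B : G → Fin m → Matrix κ κ ℂ} {N : Fin m → Matrix κ κ ℂ} {w : C → G → ℝ}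
    (hx : ∀ g, IsSystem A (x g) (B g))
    (hone : ∀ g h, g ≠ h → Separated 1 (x g) (x h))
    (hsep : ∀ g h, g ≠ h → ∀ j, Separated (A j) (x g) (x h))
    (hdisj : ∀ c c', c ≠ c' → ∀ g, w c g * w c' g = 0)
    (hw : ∀ c, ∑ g, (w c g ^ 2) = 1)
    (hN : ∀ c, ∑ g, (w c g ^ 2) • B g = N) :
    IsSystem A (fun (ca : C × ι) i => ∑ g, (w ca.1 g : ℂ) • x g ca.2 i) N := by
  refine ⟨BlockValued.combine (fun g => (hx g).one) hone hdisj fun c => ?_, fun j =>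
    BlockValued.combine (fun g => (hx g).val j) (fun g h hgh => hsep g h hgh j) hdisj fun c => ?_⟩
  · rw [← Finset.sum_smul, hw, one_smul]
  · rw [← hN c, Finset.sum_apply]
    rfl

end

/-! ### Separation and amplification by Radon's theorem -/

section

variable [CompleteSpace H]

/-- `K` is spanned by the vectors of `x` and their images under all `A j` and their adjoints; the
adjoints handle one order of the arguments, the `A j` the other. -/
lemma exists_finiteDimensional_forall_separated [Finite ι] [Finite κ] (A : Fin m → (H →L[ℂ] H))
    (x : ι → κ → H) : ∃ K : Submodule ℂ H, FiniteDimensional ℂ K ∧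
      ∀ {ι' κ' : Type*} (y : ι' → κ' → H), (∀ b k, y b k ∈ Kᗮ) →
        Separated 1 x y ∧ ∀ j, Separated (A j) x y := by
  classical
  have := Fintype.ofFinite ι
  have := Fintype.ofFinite κ
  set X : Set H := Set.range fun s : ι × κ => x s.1 s.2
  set S : Set H := X ∪ (⋃ j, A j '' X) ∪ ⋃ j, ContinuousLinearMap.adjoint (A j) '' X
  have hX : X.Finite := Set.finite_range _
  have hS : S.Finite := (hX.union (Set.finite_iUnion fun j => hX.image _)).union
    (Set.finite_iUnion fun j => hX.image _)
  refine ⟨Submodule.span ℂ S, FiniteDimensional.span_of_finite ℂ hS, fun y hy => ?_⟩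
  have h0 : ∀ s ∈ S, ∀ b k, inner ℂ s (y b k) = 0 := fun s hs b k =>
    (Submodule.mem_orthogonal _ _).1 (hy b k) s (Submodule.subset_span hs)
  have hX0 : ∀ a i, x a i ∈ X := fun a i => ⟨(a, i), rfl⟩
  refine ⟨fun a i b k => ?_, fun j a i b k => ?_⟩
  · have := h0 (x a i) (Or.inl (Or.inl (hX0 a i))) b k
    exact ⟨this, inner_eq_zero_symm.1 this⟩
  · constructor
    · rw [← ContinuousLinearMap.adjoint_inner_left]
      exact h0 _ (Or.inr (Set.mem_iUnion.2 ⟨j, _, hX0 a i, rfl⟩)) b k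
    · rw [inner_eq_zero_symm]
      exact h0 _ (Or.inl (Or.inr (Set.mem_iUnion.2 ⟨j, _, hX0 a i, rfl⟩))) b k

lemma exists_weights_of_mem_convexHull_image {V : Type*} [AddCommGroup V] [Module ℝ V] {n : ℕ} {f : Fin n → V}
    {I : Set (Fin n)} {v : V} (hv : v ∈ convexHull ℝ (f '' I)) :
    ∃ w : Fin n → ℝ, (∀ g, 0 ≤ w g) ∧ (∀ g, g ∉ I → w g = 0) ∧ ∑ g, w g = 1 ∧
      ∑ g, w g • f g = v := by
  have hc : Convex ℝ {v : V | ∃ w : Fin n → ℝ, (∀ g, 0 ≤ w g) ∧ (∀ g, g ∉ I → w g = 0) ∧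
      ∑ g, w g = 1 ∧ ∑ g, w g • f g = v} := by
    rintro _ ⟨w, h1, h2, h3, rfl⟩ _ ⟨w', h1', h2', h3', rfl⟩ s t hs ht hst
    refine ⟨fun g => s * w g + t * w' g, fun g => ?_, fun g hg => ?_, ?_, ?_⟩
    · have := h1 g; have := h1' g; positivity
    · simp [h2 g hg, h2' g hg]
    · rw [Finset.sum_add_distrib, ← Finset.mul_sum, ← Finset.mul_sum, h3, h3']; simpa
    · simp only [add_smul, mul_smul, Finset.sum_add_distrib, Finset.smul_sum]
  refine convexHull_min ?_ hc hv
  rintro _ ⟨g, hg, rfl⟩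
  refine ⟨Pi.single g 1, fun h => ?_, fun h hh => ?_, ?_, ?_⟩
  · by_cases hgh : h = g
    · subst hgh; simp
    · simp [hgh]
  · have : h ≠ g := fun e => hh (e ▸ hg)
    simp [this]
  · simp
  · rw [Finset.sum_eq_single g] <;> simp +contextual

/-- The tuples that are entrywise at distance less than `ε` from a given tuple form a convex set. -/
lemma convex_entries_lt (B : Fin m → Matrix κ κ ℂ) (ε : ℝ) :
    Convex ℝ {B' : Fin m → Matrix κ κ ℂ | ∀ j i k, ‖B' j i k - B j i k‖ < ε} := by
  intro X hX Y hY s t hs ht hst j i k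
  have := convex_ball (B j i k) ε (mem_ball_iff_norm.2 (hX j i k))
    (mem_ball_iff_norm.2 (hY j i k)) hs ht hst
  exact mem_ball_iff_norm.1 this

variable [DecidableEq ι] [DecidableEq ι'] [DecidableEq κ] [Fintype ι] [Fintype κ]

/-- An infinite sequence of pairwise separated systems near `B` is built greedily. Radon's theorem
supplies two convex combinations with disjoint supports and the same value `N`, and `N` is near `B`
because the entrywise `ε`-neighbourhood is convex. -/
lemma cofiniteRange_subset_bool_prod (A : Fin m → (H →L[ℂ] H)) :
    cofiniteRange ι A ⊆ cofiniteRange (κ := κ) (Bool × ι) A := by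
  intro B hB K hK
  rw [mem_closure_iff_entries]
  intro ε hε
  have : Std.Symm fun x y : ι → κ → H => Separated 1 x y ∧ ∀ j, Separated (A j) x y :=
    ⟨fun x y h => ⟨fun a i b k => (h.1 b k a i).symm, fun j a i b k => (h.2 j b k a i).symm⟩⟩
  obtain ⟨f, hf, hsep⟩ := exists_seq_of_forall_finset_exists'
    (fun x : ι → κ → H => (∀ a i, x a i ∈ Kᗮ) ∧ ∃ B' : Fin m → Matrix κ κ ℂ, IsSystem A x B' ∧
      ∀ j i k, ‖B' j i k - B j i k‖ < ε)
    (fun x y => Separated 1 x y ∧ ∀ j, Separated (A j) x y) (by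
      intro s _
      choose L hLfin hL using fun x : ι → κ → H => exists_finiteDimensional_forall_separated A x
      have : FiniteDimensional ℂ (K ⊔ s.sup L : Submodule ℂ H) := by
        have : FiniteDimensional ℂ (s.sup L : Submodule ℂ H) :=
          Submodule.finiteDimensional_finset_sup s L
        infer_instance
      obtain ⟨B', ⟨y, hyK, hy⟩, hB'⟩ := mem_closure_iff_entries.1 (hB _ this) ε hε
      refine ⟨y, ⟨fun a i => Submodule.orthogonal_le le_sup_left (hyK a i), B', hy, hB'⟩,
        fun x hx => hL x y fun b k => ?_⟩
      exact Submodule.orthogonal_le (le_sup_of_le_right (Finset.le_sup hx)) (hyK b k))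
  choose hfK b hb hbε using hf
  -- In real dimension `d`, any `d + 2` points are affinely dependent, as Radon's theorem requires.
  let n := Module.finrank ℝ (Fin m → Matrix κ κ ℂ) + 2
  have hdep : ¬ AffineIndependent ℝ fun g : Fin n => b g := fun h => by
    have h1 := h.card_le_finrank_succ
    have h2 := Submodule.finrank_le (vectorSpan ℝ (Set.range fun g : Fin n => b g))
    rw [Fintype.card_fin] at h1
    omega
  obtain ⟨I, N, hN1, hN2⟩ := Convex.radon_partition hdep
  obtain ⟨u, hu0, huI, hu1, huN⟩ := exists_weights_of_mem_convexHull_image hN1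
  obtain ⟨v, hv0, hvI, hv1, hvN⟩ := exists_weights_of_mem_convexHull_image hN2
  have huv : ∀ g, √(u g) * √(v g) = 0 := fun g => by
    by_cases hg : g ∈ I
    · rw [hvI g (by simpa using hg)]; simp
    · rw [huI g hg]; simp
  refine ⟨N, ⟨_, ?_, IsSystem.combine (G := Fin n) (C := Bool) (x := fun g => f g)
    (B := fun g => b g) (w := fun c g => if c then √(u g) else √(v g)) (fun g => hb g)
    (fun g h hgh => (hsep fun e => hgh (Fin.ext e)).1)
    (fun g h hgh => (hsep fun e => hgh (Fin.ext e)).2) ?_ ?_ ?_⟩, ?_⟩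
  · intro a i
    exact Submodule.sum_mem _ fun g _ => Submodule.smul_mem _ _ (hfK _ _ _)
  · rintro (_ | _) (_ | _) h g
    · simp at h
    · simpa [mul_comm] using huv g
    · simpa using huv g
    · simp at h
  · rintro (_ | _)
    · simpa [Real.sq_sqrt, hv0] using hv1
    · simpa [Real.sq_sqrt, hu0] using hu1
  · rintro (_ | _)
    · simpa [Real.sq_sqrt, hv0] using hvN
    · simpa [Real.sq_sqrt, hu0] using huN
  · refine convexHull_min ?_ (convex_entries_lt B ε) hN1
    rintro _ ⟨g, -, rfl⟩
    exact hbε g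

lemma exists_card_le_cofiniteRange_subset (A : Fin m → (H →L[ℂ] H)) (n : ℕ) :
    ∃ (ι : Type) (_ : Fintype ι) (_ : DecidableEq ι), n ≤ Fintype.card ι ∧
      cofiniteRange Unit A ⊆ cofiniteRange (κ := κ) ι A := by
  induction n with
  | zero => exact ⟨Unit, inferInstance, inferInstance, by simp, subset_rfl⟩
  | succ n ih =>
    obtain ⟨ι, _, _, hn, h⟩ := ih
    -- Doubling a cardinality that is at least `n` reaches `n + 1` only when `n ≥ 1`.
    by_cases h0 : n = 0
    · exact ⟨Unit, inferInstance, inferInstance, by simp [h0], subset_rfl⟩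
    · refine ⟨Bool × ι, inferInstance, inferInstance, ?_,
        h.trans (cofiniteRange_subset_bool_prod A)⟩
      rw [Fintype.card_prod, Fintype.card_bool]
      omega

lemma cofiniteRange_unit_subset (ι : Type*) [DecidableEq ι] [Fintype ι]
    (A : Fin m → (H →L[ℂ] H)) :
    cofiniteRange Unit A ⊆ cofiniteRange (κ := κ) ι A := by
  obtain ⟨ι', _, _, hn, h⟩ :=
    exists_card_le_cofiniteRange_subset (κ := κ) A (Fintype.card ι)
  obtain ⟨e⟩ := Function.Embedding.nonempty_of_card_le hn
  exact h.trans (cofiniteRange_subset_of_injective e.injective)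

end

end

end MatricialRange

/-! ### Compactness, convexity and the dimension count -/

namespace MatricialRange

section

variable {H : Type*} [NormedAddCommGroup H] [InnerProductSpace ℂ H]
variable {ι κ : Type*} {m : ℕ} [DecidableEq ι] [DecidableEq κ]

lemma IsSystem.norm_entry_le {A : Fin m → (H →L[ℂ] H)} {x : ι → κ → H}
    {B : Fin m → Matrix κ κ ℂ} (h : IsSystem A x B) (a : ι) (j : Fin m) (i k : κ) :
    ‖B j i k‖ ≤ ‖A j‖ := by
  have h1 := h.val j a i a k
  rw [if_pos rfl] at h1
  rw [← h1]
  calc _ ≤ ‖x a i‖ * ‖A j (x a k)‖ := norm_inner_le_norm _ _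
    _ ≤ ‖x a i‖ * (‖A j‖ * ‖x a k‖) := by gcongr; exact (A j).le_opNorm _
    _ = ‖A j‖ := by rw [h.norm_eq_one, h.norm_eq_one]; ring

omit [DecidableEq κ] in
lemma isCompact_entries_le (c : Fin m → ℝ) :
    IsCompact {B : Fin m → Matrix κ κ ℂ | ∀ j i k, ‖B j i k‖ ≤ c j} := by
  have : IsCompact (Set.pi Set.univ fun j => Set.pi Set.univ fun _ => Set.pi Set.univ fun _ =>
      Metric.closedBall 0 (c j) : Set (Fin m → κ → κ → ℂ)) :=
    isCompact_univ_pi fun j => isCompact_univ_pi fun _ => isCompact_univ_pi fun _ =>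
      isCompact_closedBall _ _
  have h : {B : Fin m → κ → κ → ℂ | ∀ j i k, ‖B j i k‖ ≤ c j} =
      Set.pi Set.univ fun j => Set.pi Set.univ fun _ => Set.pi Set.univ fun _ =>
        Metric.closedBall 0 (c j) := by
    ext B
    simp [Set.mem_pi]
  rw [← h] at this
  exact this

lemma isCompact_closure_blockRange [Nonempty ι] (A : Fin m → (H →L[ℂ] H))
    (K : Submodule ℂ H) : IsCompact (closure (blockRange (κ := κ) ι A K)) := by
  have := isCompact_entries_le (κ := κ) fun j => ‖A j‖
  refine this.closure_of_subset ?_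
  rintro B ⟨x, -, hx⟩ j i k
  exact hx.norm_entry_le (Classical.arbitrary ι) j i k

lemma cofiniteRange_eq_iInter (A : Fin m → (H →L[ℂ] H)) :
    cofiniteRange (κ := κ) ι A =
      ⋂ K : {K : Submodule ℂ H // FiniteDimensional ℂ K}, closure (blockRange ι A K) := by
  ext B
  simp [cofiniteRange]

lemma isCompact_cofiniteRange [Nonempty ι] (A : Fin m → (H →L[ℂ] H)) :
    IsCompact (cofiniteRange (κ := κ) ι A) := by
  rw [cofiniteRange_eq_iInter]
  have h0 : FiniteDimensional ℂ (⊥ : Submodule ℂ H) := inferInstance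
  exact (isCompact_closure_blockRange A ⊥).of_isClosed_subset
    (isClosed_iInter fun _ => isClosed_closure)
    (Set.iInter_subset_of_subset ⟨⊥, h0⟩ subset_rfl)

lemma exists_norm_eq_one_mem_orthogonal (hH : ¬ FiniteDimensional ℂ H) (K : Submodule ℂ H)
    [FiniteDimensional ℂ K] : ∃ x ∈ Kᗮ, ‖x‖ = 1 := by
  have h : Kᗮ ≠ ⊥ := fun h => by
    rw [Submodule.orthogonal_eq_bot_iff] at h
    subst h
    exact hH (Module.Finite.equiv (Submodule.topEquiv (R := ℂ) (M := H)))
  obtain ⟨x, hx, hx0⟩ := Submodule.exists_mem_ne_zero_of_ne_bot h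
  exact ⟨((‖x‖⁻¹ : ℝ) : ℂ) • x, Submodule.smul_mem _ _ hx, by
    rw [norm_smul, Complex.norm_real, norm_inv, norm_norm, inv_mul_cancel₀ (norm_ne_zero_iff.2 hx0)]⟩

lemma isSystem_unit {A : Fin m → (H →L[ℂ] H)} {x : H} (hx : ‖x‖ = 1) :
    IsSystem A (fun _ _ : Unit => x) (fun j _ _ => inner ℂ x (A j x)) := by
  refine ⟨fun _ _ _ _ => ?_, fun j _ _ _ _ => ?_⟩
  · simp [inner_self_eq_norm_sq_to_K, hx]
  · simp

/-- The closures form a directed family of nonempty compact sets. A point of the intersection later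
serves as the scalar value placed on `K`. -/
lemma nonempty_cofiniteRange (hH : ¬ FiniteDimensional ℂ H) (A : Fin m → (H →L[ℂ] H)) :
    (cofiniteRange (κ := Unit) Unit A).Nonempty := by
  rw [cofiniteRange_eq_iInter]
  have h0 : FiniteDimensional ℂ (⊥ : Submodule ℂ H) := inferInstance
  have : Nonempty {K : Submodule ℂ H // FiniteDimensional ℂ K} := ⟨⟨⊥, h0⟩⟩
  refine IsCompact.nonempty_iInter_of_directed_nonempty_isCompact_isClosed _ ?_ ?_
    (fun K => isCompact_closure_blockRange A _) fun K => isClosed_closure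
  · rintro ⟨K, hK⟩ ⟨L, hL⟩
    exact ⟨⟨K ⊔ L, inferInstance⟩, closure_mono (blockRange_antitone le_sup_left),
      closure_mono (blockRange_antitone le_sup_right)⟩
  · rintro ⟨K, hK⟩
    obtain ⟨x, hxK, hx⟩ := exists_norm_eq_one_mem_orthogonal hH K
    exact Set.Nonempty.closure ⟨_, fun _ _ => x, fun _ _ => hxK, isSystem_unit hx⟩

lemma exists_block_of_mem_cofiniteRange [Fintype κ] {A : Fin m → (H →L[ℂ] H)}
    {B : Fin m → Matrix κ κ ℂ} (hB : B ∈ cofiniteRange ι A) (K : Submodule ℂ H)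
    [hK : FiniteDimensional ℂ K] {ε : ℝ} (hε : 0 < ε) :
    ∃ B' x, (∀ a i, x a i ∈ Kᗮ) ∧ IsSystem (ι := ι) A x B' ∧
      ∀ j i k, ‖B' j i k - B j i k‖ < ε := by
  obtain ⟨B', ⟨x, h1, h2⟩, h3⟩ := mem_closure_iff_entries.1 (hB K hK) ε hε
  exact ⟨B', x, h1, h2, h3⟩

section

variable [CompleteSpace H] [Fintype κ]

/-- The system for `B'` is chosen first, and the one for `B` is then found separated from it. Only
`B` needs to be approximable off every finite-dimensional subspace, hence star-centers as well as
convexity. -/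
lemma cofiniteRange_smul_add_smul_mem [Finite ι] {A : Fin m → (H →L[ℂ] H)}
    {B B' : Fin m → Matrix κ κ ℂ}
    {K : Submodule ℂ H} [FiniteDimensional ℂ K] (hB : B ∈ cofiniteRange ι A)
    (hB' : B' ∈ closure (blockRange ι A K)) {s t : ℝ} (hs : 0 ≤ s) (ht : 0 ≤ t) (hst : s + t = 1) :
    s • B + t • B' ∈ closure (blockRange ι A K) := by
  rw [mem_closure_iff_entries] at hB' ⊢
  intro ε hε
  obtain ⟨C', ⟨y, hyK, hy⟩, hC'⟩ := hB' ε hε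
  obtain ⟨L, hLfin, hL⟩ := exists_finiteDimensional_forall_separated A y
  obtain ⟨C, x, hxK, hx, hC⟩ := exists_block_of_mem_cofiniteRange hB (K ⊔ L) hε
  have hsep := hL x fun b k => Submodule.orthogonal_le le_sup_right (hxK b k)
  refine ⟨s • C + t • C', ⟨_, ?_, (IsSystem.combine (G := Bool) (C := Unit)
    (x := fun g => if g then x else y) (B := fun g => if g then C else C')
    (w := fun _ g => if g then √s else √t) ?_ ?_ ?_ ?_ ?_ ?_).comp_injective
      (e := fun a => ((), a)) (fun a b h => (Prod.mk.inj h).2)⟩, ?_⟩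
  · intro a i
    refine Submodule.sum_mem _ fun g _ => Submodule.smul_mem _ _ ?_
    cases g
    · exact hyK a i
    · exact Submodule.orthogonal_le le_sup_left (hxK a i)
  · rintro (_ | _)
    · exact hy
    · exact hx
  · rintro (_ | _) (_ | _) h
    · exact absurd rfl h
    · exact hsep.1
    · exact fun a i b k => (hsep.1 b k a i).symm
    · exact absurd rfl h
  · rintro (_ | _) (_ | _) h j
    · exact absurd rfl h
    · exact hsep.2 j
    · exact fun a i b k => (hsep.2 j b k a i).symm
    · exact absurd rfl h
  · exact fun c c' h => absurd rfl h
  · intro c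
    simp [Real.sq_sqrt, hs, ht, hst]
  · intro c
    simp [Real.sq_sqrt, hs, ht]
  · intro j i k
    have h1 : (s • C + t • C') j i k - (s • B + t • B') j i k =
        s • (C j i k - B j i k) + t • (C' j i k - B' j i k) := by
      simp only [Pi.add_apply, Pi.smul_apply, Matrix.add_apply, Matrix.smul_apply, smul_sub]
      abel
    rw [h1]
    have := convex_ball (0 : ℂ) ε (mem_ball_zero_iff.2 (hC j i k))
      (mem_ball_zero_iff.2 (hC' j i k)) hs ht hst
    exact mem_ball_zero_iff.1 this

lemma convex_cofiniteRange [Finite ι] (A : Fin m → (H →L[ℂ] H)) :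
    Convex ℝ (cofiniteRange (κ := κ) ι A) :=
  fun _ hB _ hB' _ _ hs ht hst K hK => cofiniteRange_smul_add_smul_mem hB (hB' K hK) hs ht hst

end

omit [DecidableEq κ] in
lemma BlockValued.of_coeff [Fintype ι] {T : H →L[ℂ] H} {x : ι → κ → H} {M : Matrix κ κ ℂ}
    (h : BlockValued T x M) {v : EuclideanSpace ℂ ι} (hv : ‖v‖ = 1) :
    BlockValued T (fun (_ : Unit) i => ∑ a, v a • x a i) M := by
  intro _ i _ k
  change inner ℂ (∑ a, v a • x a i) (T (∑ a, v a • x a k)) = _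
  rw [map_sum, sum_inner]
  simp_rw [inner_sum, map_smul, inner_smul_left, inner_smul_right, h _ _ _ _, mul_ite, mul_zero,
    Finset.sum_ite_eq, Finset.mem_univ, if_true, ← mul_assoc, ← Finset.sum_mul]
  have h1 : ∑ a, (starRingEnd ℂ) (v a) * v a = 1 := by
    have := inner_self_eq_norm_sq_to_K (𝕜 := ℂ) v
    rw [PiLp.inner_apply, hv] at this
    simp_rw [Complex.conj_mul']
    simpa using this
  rw [h1, one_mul]

/-- A unit `u` turns `I ⊗ B` into one copy of `B`, spanned by the `∑ a, u a • x a i`. Lying in `Kᗮ`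
imposes `card κ * finrank K` linear conditions on `u`, fewer than its coordinates. -/
lemma blockRange_subset_of_finrank_lt [Fintype ι] [Fintype κ] {A : Fin m → (H →L[ℂ] H)}
    {K : Submodule ℂ H} [FiniteDimensional ℂ K]
    (h : Fintype.card κ * Module.finrank ℂ K < Fintype.card ι) :
    blockRange (κ := κ) ι A ⊥ ⊆ blockRange Unit A K := by
  rintro B ⟨x, -, hx⟩
  let Φ : EuclideanSpace ℂ ι →ₗ[ℂ] (κ → K) := LinearMap.pi fun i =>
    ∑ a, (EuclideanSpace.proj a : EuclideanSpace ℂ ι →L[ℂ] ℂ).toLinearMap.smulRight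
      (K.orthogonalProjectionOnto (x a i))
  have hΦ : LinearMap.ker Φ ≠ ⊥ := LinearMap.ker_ne_bot_of_finrank_lt (by
    rw [Module.finrank_pi_fintype, finrank_euclideanSpace]
    simpa using h)
  obtain ⟨v, hv, hv0⟩ := Submodule.exists_mem_ne_zero_of_ne_bot hΦ
  set u : EuclideanSpace ℂ ι := ((‖v‖⁻¹ : ℝ) : ℂ) • v
  have hu : ‖u‖ = 1 := by
    rw [norm_smul, Complex.norm_real, norm_inv, norm_norm, inv_mul_cancel₀ (norm_ne_zero_iff.2 hv0)]
  have hu0 : Φ u = 0 := by rw [map_smul, LinearMap.mem_ker.1 hv, smul_zero]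
  refine ⟨fun _ i => ∑ a, u a • x a i, fun _ i => ?_, hx.one.of_coeff hu,
    fun j => (hx.val j).of_coeff hu⟩
  rw [← Submodule.orthogonalProjectionOnto_eq_zero_iff]
  have := congrFun hu0 i
  simpa [Φ, LinearMap.sum_apply] using this

lemma iInter_closure_blockRange_subset [Fintype κ] (A : Fin m → (H →L[ℂ] H)) :
    ⋂ (r : ℕ) (_ : 1 ≤ r), closure (blockRange (κ := κ) (Fin r) A ⊥) ⊆ cofiniteRange Unit A := by
  intro B hB K hK
  simp only [Set.mem_iInter] at hB
  exact closure_mono (blockRange_subset_of_finrank_lt (by simp))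
    (hB (Fintype.card κ * Module.finrank ℂ K + 1) (by omega))

end

end MatricialRange

/-! ### Finite rank perturbations -/

namespace MatricialRange

section

variable {H : Type*} [NormedAddCommGroup H] [InnerProductSpace ℂ H]
variable {ι κ : Type*} {m : ℕ}

/-- The `z s` replace the orthonormal basis `e` of `K`: transplanting `u i` to `∑ s, inner ℂ (e s)
(u i) • z s ()` turns the form of `T` into `a` times the inner product of `K`. -/
lemma inner_add_sum_smul {T : H →L[ℂ] H} {K : Submodule ℂ H} [Fintype ι] [DecidableEq ι]
    (e : OrthonormalBasis ι ℂ K) {y : Unit → κ → H} {z : ι → Unit → H} {a : Matrix Unit Unit ℂ}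
    (hz : BlockValued T z a) (hyz : Separated T y z) (u : κ → K) (i k : κ) :
    inner ℂ (y () i + ∑ s, inner ℂ (e s) (u i) • z s ())
      (T (y () k + ∑ s, inner ℂ (e s) (u k) • z s ())) =
    inner ℂ (y () i) (T (y () k)) + a () () * inner ℂ (u i) (u k) := by
  have h1 : inner ℂ (y () i) (∑ s, inner ℂ (e s) (u k) • T (z s ())) = 0 := by
    rw [inner_sum]
    exact Finset.sum_eq_zero fun s _ => by rw [inner_smul_right, (hyz () i s ()).1, mul_zero]
  have h2 : inner ℂ (∑ s, inner ℂ (e s) (u i) • z s ()) (T (y () k)) = 0 := by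
    rw [sum_inner]
    exact Finset.sum_eq_zero fun s _ => by rw [inner_smul_left, (hyz () k s ()).2, mul_zero]
  have h3 : inner ℂ (∑ s, inner ℂ (e s) (u i) • z s ()) (∑ s, inner ℂ (e s) (u k) • T (z s ())) =
      a () () * inner ℂ (u i) (u k) := by
    rw [sum_inner, ← e.sum_inner_mul_inner, Finset.mul_sum]
    refine Finset.sum_congr rfl fun s _ => ?_
    simp_rw [inner_sum, inner_smul_left, inner_smul_right, hz _ _ _ _, mul_ite, mul_zero,
      Finset.sum_ite_eq, Finset.mem_univ, if_true, inner_conj_symm]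
    ring
  simp only [map_add, map_sum, map_smul, inner_add_left, inner_add_right]
  rw [h1, h2, h3]
  ring

section

lemma isFiniteRank_of_range_le {F : H →L[ℂ] H} {K : Submodule ℂ H} [FiniteDimensional ℂ K]
    (h : ∀ x, F x ∈ K) : IsFiniteRank F := by
  have : LinearMap.range (F : H →ₗ[ℂ] H) ≤ K := by
    rintro _ ⟨x, rfl⟩
    exact h x
  exact Submodule.finiteDimensional_of_le this

lemma exists_finiteRank_compression_add_smul (T : H →L[ℂ] H) (a : ℂ) (K : Submodule ℂ H)
    [FiniteDimensional ℂ K] : ∃ F : H →L[ℂ] H, IsFiniteRank F ∧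
      ∀ x x', inner ℂ x ((T + F) x') =
        inner ℂ (x - K.starProjection x) (T (x' - K.starProjection x')) +
          a * inner ℂ (K.orthogonalProjectionOnto x) (K.orthogonalProjectionOnto x') := by
  set P := K.starProjection
  -- The perturbed operator is `(1 - P) T (1 - P) + a P`; the correction has range in `K + T K`.
  refine ⟨(1 - P) ∘L T ∘L (1 - P) + a • P - T, ?_, fun x x' => ?_⟩
  · refine isFiniteRank_of_range_le (K := K ⊔ K.map (T : H →ₗ[ℂ] H)) fun x => ?_
    have h : ((1 - P) ∘L T ∘L (1 - P) + a • P - T : H →L[ℂ] H) x =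
        (a • P x - P (T (x - P x))) + (T : H →ₗ[ℂ] H) (-P x) := by
      simp
      abel
    rw [h]
    refine Submodule.add_mem_sup (Submodule.sub_mem _ (Submodule.smul_mem _ _ ?_) ?_)
      (Submodule.mem_map_of_mem (Submodule.neg_mem _ ?_))
    all_goals exact Submodule.starProjection_apply_mem _ _
  · have h : (T + ((1 - P) ∘L T ∘L (1 - P) + a • P - T) : H →L[ℂ] H) x' =
        (1 - P) (T (x' - P x')) + a • P x' := by
      simp
      abel
    rw [h, inner_add_right, inner_smul_right]
    have h1 : inner ℂ x ((1 - P) (T (x' - P x'))) = inner ℂ (x - P x) (T (x' - P x')) := by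
      have := Submodule.inner_starProjection_left_eq_right K x (T (x' - P x'))
      simp only [sub_apply, one_apply_eq_self, inner_sub_right, inner_sub_left]
        at this ⊢
      rw [this]
    have h2 : inner ℂ x (P x') =
        inner ℂ (K.orthogonalProjectionOnto x) (K.orthogonalProjectionOnto x') := by
      rw [Submodule.coe_inner, ← Submodule.starProjection_apply, ← Submodule.starProjection_apply,
        Submodule.inner_starProjection_left_eq_right]
      congr 1
      exact ((Submodule.starProjection_eq_self_iff).2 (Submodule.starProjection_apply_mem _ _)).symm
    rw [h1, h2]

lemma inner_sub_starProjection_add (K : Submodule ℂ H) [FiniteDimensional ℂ K] (x x' : H) :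
    inner ℂ (x - K.starProjection x) (x' - K.starProjection x') +
      inner ℂ (K.orthogonalProjectionOnto x) (K.orthogonalProjectionOnto x') = inner ℂ x x' := by
  have h := Submodule.starProjection_inner_eq_zero (K := K) x (K.starProjection x')
    (Submodule.starProjection_apply_mem _ _)
  have h' := Submodule.starProjection_inner_eq_zero (K := K) x' (K.starProjection x)
    (Submodule.starProjection_apply_mem _ _)
  rw [inner_eq_zero_symm] at h'
  rw [Submodule.coe_inner, ← Submodule.starProjection_apply, ← Submodule.starProjection_apply]
  simp only [inner_sub_left, inner_sub_right] at h h' ⊢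
  linear_combination -h - h'

variable [CompleteSpace H]

/-- After perturbation, a system splits into its part `y` in `Kᗮ` and its part `u` in `K`, where `A
+ F` acts as `a`. Since `a` can be approximated with `finrank K` copies in `Kᗮ`, separated from `y`,
the part `u` moves there without changing inner products. Each of the two approximations costs `ε /
2`, as `‖u i‖ ≤ 1`. -/
lemma mem_cofiniteRange_of_finiteRank [DecidableEq κ] [Fintype κ] (hH : ¬ FiniteDimensional ℂ H)
    {A : Fin m → (H →L[ℂ] H)} {B : Fin m → Matrix κ κ ℂ}
    (hB : ∀ F : Fin m → (H →L[ℂ] H), (∀ j, IsFiniteRank (F j)) →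
      B ∈ closure (blockRange Unit (A + F) ⊥)) : B ∈ cofiniteRange Unit A := by
  intro K hK
  rw [mem_closure_iff_entries]
  intro ε hε
  obtain ⟨a, ha⟩ := nonempty_cofiniteRange hH A
  choose F hF hFin using fun j => exists_finiteRank_compression_add_smul (A j) (a j () ()) K
  obtain ⟨B', ⟨x, -, hx⟩, hB'⟩ := mem_closure_iff_entries.1 (hB F hF) (ε / 2) (half_pos hε)
  let y : Unit → κ → H := fun _ i => x () i - K.starProjection (x () i)
  let u : κ → K := fun i => K.orthogonalProjectionOnto (x () i)
  have hyK : ∀ i, y () i ∈ Kᗮ := fun i => Submodule.sub_starProjection_mem_orthogonal _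
  obtain ⟨L, hLfin, hL⟩ := exists_finiteDimensional_forall_separated A y
  let e := stdOrthonormalBasis ℂ K
  obtain ⟨a', z, hzK, hz, ha'⟩ := exists_block_of_mem_cofiniteRange
    (cofiniteRange_unit_subset (Fin (Module.finrank ℂ K)) A ha) (K ⊔ L) (half_pos hε)
  have hsep := hL z fun b k => Submodule.orthogonal_le le_sup_right (hzK b k)
  have hu : ∀ i, ‖u i‖ ≤ 1 := fun i => by
    have := K.norm_orthogonalProjectionOnto_apply_le (x () i)
    rwa [hx.norm_eq_one] at this
  refine ⟨fun j i k => inner ℂ (y () i) (A j (y () k)) + a' j () () * inner ℂ (u i) (u k),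
    ⟨fun _ i => y () i + ∑ s, inner ℂ (e s) (u i) • z s (), fun _ i => ?_, ?_, ?_⟩, ?_⟩
  · exact Submodule.add_mem _ (hyK i) (Submodule.sum_mem _ fun s _ => Submodule.smul_mem _ _
      (Submodule.orthogonal_le le_sup_left (hzK _ _)))
  · rintro ⟨⟩ i ⟨⟩ k
    refine (inner_add_sum_smul e hz.one hsep.1 u i k).trans ?_
    have := hx.one () i () k
    rw [if_pos rfl] at this ⊢
    rw [← this, one_apply_eq_self, one_apply_eq_self, Matrix.one_apply_eq, one_mul]
    exact inner_sub_starProjection_add K _ _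
  · rintro j ⟨⟩ i ⟨⟩ k
    rw [if_pos rfl]
    exact inner_add_sum_smul e (hz.val j) (hsep.2 j) u i k
  · intro j i k
    have h1 := hx.val j () i () k
    rw [if_pos rfl, Pi.add_apply, hFin] at h1
    have h2 : inner ℂ (y () i) (A j (y () k)) + a' j () () * inner ℂ (u i) (u k) - B j i k =
        (B' j i k - B j i k) + (a' j () () - a j () ()) * inner ℂ (u i) (u k) := by
      rw [← h1]
      ring
    have h3 : ‖inner ℂ (u i) (u k)‖ ≤ 1 := (norm_inner_le_norm _ _).trans
      (mul_le_one₀ (hu i) (norm_nonneg _) (hu k))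
    rw [h2]
    calc _ ≤ ‖B' j i k - B j i k‖ + ‖a' j () () - a j () ()‖ * ‖inner ℂ (u i) (u k)‖ :=
          (norm_add_le _ _).trans_eq (by rw [norm_mul])
      _ ≤ ‖B' j i k - B j i k‖ + ‖a' j () () - a j () ()‖ * 1 := by gcongr
      _ < ε := by linarith [hB' j i k, ha' j () ()]

/-- Amplifying the scalar tuple to `κ` copies gives `I ⊗ a'`, which is also a single block `a' • 1`.
-/
lemma smul_one_mem_cofiniteRange [DecidableEq κ] [Fintype κ] {A : Fin m → (H →L[ℂ] H)}
    {a : Fin m → Matrix Unit Unit ℂ} (ha : a ∈ cofiniteRange Unit A) :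
    (fun j => a j () () • (1 : Matrix κ κ ℂ)) ∈ cofiniteRange Unit A := by
  intro K hK
  rw [mem_closure_iff_entries]
  intro ε hε
  obtain ⟨a', z, hzK, hz, ha'⟩ :=
    exists_block_of_mem_cofiniteRange (cofiniteRange_unit_subset κ A ha) K hε
  refine ⟨fun j => a' j () () • 1, ⟨fun _ i => z i (), fun _ i => hzK _ _, ?_, ?_⟩, ?_⟩
  · rintro ⟨⟩ i ⟨⟩ k
    rw [hz.one]
    simp [Matrix.one_apply]
  · rintro j ⟨⟩ i ⟨⟩ k
    rw [hz.val]
    simp [Matrix.one_apply]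
  · intro j i k
    by_cases h : i = k
    · simpa [h] using ha' j () ()
    · simpa [h] using hε

omit [CompleteSpace H] in
-- Off the ranges of the `F j`, the compressions of `A` and `A + F` coincide.
lemma cofiniteRange_subset_closure_add [DecidableEq ι] [DecidableEq κ] {A F : Fin m → (H →L[ℂ] H)}
    (hF : ∀ j, IsFiniteRank (F j)) :
    cofiniteRange (κ := κ) ι A ⊆ closure (blockRange ι (A + F) ⊥) := by
  intro B hB
  have hfin : ∀ j, FiniteDimensional ℂ (LinearMap.range (F j : H →ₗ[ℂ] H)) := hF
  refine closure_mono ?_ (hB (⨆ j, LinearMap.range (F j : H →ₗ[ℂ] H)) inferInstance)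
  rintro C ⟨x, hxK, hx⟩
  refine ⟨x, fun _ _ => by simp, hx.one, fun j a i b k => ?_⟩
  have h : inner ℂ (x a i) (F j (x b k)) = 0 := inner_eq_zero_symm.1
    ((Submodule.mem_orthogonal _ _).1 (hxK a i) _
      (Submodule.mem_iSup_of_mem j ⟨x b k, rfl⟩))
  rw [Pi.add_apply, add_apply, inner_add_right, h, add_zero, hx.val]

end

end

end MatricialRange

/-! ### From isometries to orthonormal systems, and the equalities -/

namespace MatricialRange

section

variable {H : Type*} [NormedAddCommGroup H] [InnerProductSpace ℂ H] [CompleteSpace H]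
variable {m : ℕ}

lemma inner_compression {E : Type*} [NormedAddCommGroup E] [InnerProductSpace ℂ E]
    [CompleteSpace E] (Y : E →ₗᵢ[ℂ] H) (T : H →L[ℂ] H) (u v : E) :
    inner ℂ u (compression Y T v) = inner ℂ (Y u) (T (Y v)) := by
  simp [compression, ContinuousLinearMap.adjoint_inner_right]

lemma inner_toEuclideanCLM_basisFun {n : Type*} [Fintype n] [DecidableEq n] (M : Matrix n n ℂ)
    (s t : n) : inner ℂ (EuclideanSpace.basisFun n ℂ s)
      (Matrix.toEuclideanCLM (𝕜 := ℂ) M (EuclideanSpace.basisFun n ℂ t)) = M s t := by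
  rw [EuclideanSpace.basisFun_inner, Matrix.ofLp_toEuclideanCLM]
  simp

lemma compression_eq_toEuclideanCLM_iff {n : Type*} [Fintype n] [DecidableEq n]
    (X : EuclideanSpace ℂ n →ₗᵢ[ℂ] H) (T : H →L[ℂ] H) (M : Matrix n n ℂ) :
    compression X T = Matrix.toEuclideanCLM (𝕜 := ℂ) M ↔
      ∀ s t, inner ℂ (X (EuclideanSpace.basisFun n ℂ s))
        (T (X (EuclideanSpace.basisFun n ℂ t))) = M s t := by
  constructor
  · intro hX s t
    rw [← inner_compression, hX, inner_toEuclideanCLM_basisFun]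
  · intro hX
    refine ContinuousLinearMap.coe_injective ((EuclideanSpace.basisFun n ℂ).toBasis.ext fun t => ?_)
    simp only [OrthonormalBasis.coe_toBasis, ContinuousLinearMap.coe_coe]
    refine (EuclideanSpace.basisFun n ℂ).repr.injective (PiLp.ext fun s => ?_)
    rw [OrthonormalBasis.repr_apply_apply, OrthonormalBasis.repr_apply_apply]
    rw [inner_compression, hX, inner_toEuclideanCLM_basisFun]

lemma exists_compression_eq_iff {n : Type*} [Fintype n] [DecidableEq n]
    (A : Fin m → (H →L[ℂ] H)) (M : Fin m → Matrix n n ℂ) :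
    (∃ X : EuclideanSpace ℂ n →ₗᵢ[ℂ] H,
      ∀ j, compression X (A j) = Matrix.toEuclideanCLM (𝕜 := ℂ) (M j)) ↔
    ∃ x : n → H, Orthonormal ℂ x ∧ ∀ j s t, inner ℂ (x s) (A j (x t)) = M j s t := by
  simp only [compression_eq_toEuclideanCLM_iff]
  constructor
  · rintro ⟨X, hX⟩
    exact ⟨_, (EuclideanSpace.basisFun n ℂ).orthonormal.comp_linearIsometry X, hX⟩
  · rintro ⟨x, hx, hxM⟩
    let b := (EuclideanSpace.basisFun n ℂ).toBasis
    have hb : Orthonormal ℂ b := by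
      simp [b]
    have hbx : b.constr ℂ x ∘ b = x := funext fun s => b.constr_basis ℂ x s
    refine ⟨(b.constr ℂ x).isometryOfOrthonormal hb (by rwa [hbx]), fun j s t => ?_⟩
    have h : ∀ s, b.constr ℂ x (EuclideanSpace.basisFun n ℂ s) = x s := fun s => by
      rw [← OrthonormalBasis.coe_toBasis]
      exact congrFun hbx s
    simp only [LinearMap.coe_isometryOfOrthonormal, h, hxM]

lemma jointMatricialRange_eq_blockRange (p q : ℕ) (A : Fin m → (H →L[ℂ] H)) :
    jointMatricialRange p q A = blockRange (Fin p) A ⊥ := by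
  ext B
  refine (exists_compression_eq_iff A fun j =>
    Matrix.kroneckerMap (· * ·) (1 : Matrix (Fin p) (Fin p) ℂ) (B j)).trans ?_
  have h : ∀ (M : Matrix (Fin q) (Fin q) ℂ) (a b : Fin p) (i k : Fin q),
      Matrix.kroneckerMap (· * ·) (1 : Matrix (Fin p) (Fin p) ℂ) M (a, i) (b, k) =
        if a = b then M i k else 0 := fun M a b i k => by
    simp [Matrix.kroneckerMap_apply, Matrix.one_apply]
  constructor
  · rintro ⟨x, hx, hxB⟩
    refine ⟨fun a i => x (a, i), fun _ _ => by simp, fun a i b k => ?_, fun j a i b k => ?_⟩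
    · rw [one_apply_eq_self, orthonormal_iff_ite.1 hx]
      simp [Matrix.one_apply, ite_and]
    · rw [hxB, h]
  · rintro ⟨x, -, hx⟩
    refine ⟨fun s => x s.1 s.2, orthonormal_iff_ite.2 ?_, ?_⟩
    · rintro ⟨a, i⟩ ⟨b, k⟩
      have := hx.one a i b k
      rw [one_apply_eq_self] at this
      rw [this]
      simp [Matrix.one_apply, ite_and]
    · rintro j ⟨a, i⟩ ⟨b, k⟩
      rw [h, hx.val]

lemma jointQMatricialRange_eq_blockRange (q : ℕ) (A : Fin m → (H →L[ℂ] H)) :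
    jointQMatricialRange q A = blockRange Unit A ⊥ := by
  ext B
  refine (exists_compression_eq_iff A B).trans ?_
  constructor
  · rintro ⟨x, hx, hxB⟩
    refine ⟨fun _ i => x i, fun _ _ => by simp, fun _ i _ k => ?_, fun j _ i _ k => ?_⟩
    · rw [one_apply_eq_self, orthonormal_iff_ite.1 hx]
      simp [Matrix.one_apply]
    · rw [hxB, if_pos rfl]
  · rintro ⟨x, -, hx⟩
    refine ⟨x (), orthonormal_iff_ite.2 fun i k => ?_, fun j i k => ?_⟩
    · have := hx.one () i () k
      rw [one_apply_eq_self, if_pos rfl, Matrix.one_apply] at this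
      exact this
    · rw [hx.val, if_pos rfl]

omit [CompleteSpace H] in
lemma mem_closure_blockRange_of_jointNumericalRange {A : Fin m → (H →L[ℂ] H)} {a : Fin m → ℂ}
    (ha : a ∈ closure (jointNumericalRange A)) :
    (fun j _ _ => a j : Fin m → Matrix Unit Unit ℂ) ∈ closure (blockRange Unit A ⊥) := by
  refine map_mem_closure (f := fun (a : Fin m → ℂ) => (fun j => (fun _ _ => a j : Matrix Unit Unit ℂ)))
    ?_ ha ?_
  · exact continuous_pi fun j => continuous_matrix fun _ _ => continuous_apply j
  · rintro b ⟨x, hx, hb⟩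
    obtain rfl : b = fun j => inner ℂ x (A j x) := funext hb
    exact ⟨fun _ _ => x, fun _ _ => by simp, isSystem_unit hx⟩

section

variable {ι κ : Type*} [DecidableEq ι] [DecidableEq κ]
variable {E : Type*} [NormedAddCommGroup E] [InnerProductSpace ℂ E] [CompleteSpace E]

lemma isSystem_compression_iff {A : Fin m → (H →L[ℂ] H)} {Y : E →ₗᵢ[ℂ] H} {x : ι → κ → E}
    {B : Fin m → Matrix κ κ ℂ} :
    IsSystem (fun j => compression Y (A j)) x B ↔ IsSystem A (fun a i => Y (x a i)) B := by
  have h1 : BlockValued (1 : E →L[ℂ] E) x (1 : Matrix κ κ ℂ) ↔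
      BlockValued (1 : H →L[ℂ] H) (fun a i => Y (x a i)) 1 := by
    simp [BlockValued, LinearIsometry.inner_map_map]
  have h2 : ∀ j, BlockValued (compression Y (A j)) x (B j) ↔
      BlockValued (A j) (fun a i => Y (x a i)) (B j) := fun j => by
    simp [BlockValued, inner_compression]
  exact ⟨fun h => ⟨h1.1 h.one, fun j => (h2 j).1 (h.val j)⟩,
    fun h => ⟨h1.2 h.one, fun j => (h2 j).2 (h.val j)⟩⟩

lemma cofiniteRange_subset_closure_compression (A : Fin m → (H →L[ℂ] H)) (Y : E →ₗᵢ[ℂ] H)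
    [hY : FiniteDimensional ℂ (LinearMap.range Y.toLinearMap)ᗮ] :
    cofiniteRange (κ := κ) ι A ⊆ closure (blockRange ι (fun j => compression Y (A j)) ⊥) := by
  intro B hB
  refine closure_mono ?_ (hB _ hY)
  -- The range of `Y` is closed, so it equals its double orthogonal complement and systems there
  -- pull back along `Y`.
  have hc : IsComplete ((LinearMap.range Y.toLinearMap : Submodule ℂ H) : Set H) := by
    have h : ((LinearMap.range Y.toLinearMap : Submodule ℂ H) : Set H) = Set.range Y := rfl
    rw [h]
    exact Y.isometry.isUniformInducing.isComplete_range
  have : CompleteSpace (LinearMap.range Y.toLinearMap) := hc.completeSpace_coe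
  rintro C ⟨x, hxK, hx⟩
  rw [Submodule.orthogonal_orthogonal] at hxK
  choose z hz using hxK
  have hz' : (fun a i => Y (z a i)) = x := funext fun a => funext fun i => hz a i
  exact ⟨z, fun _ _ => by simp, isSystem_compression_iff.2 (by rwa [hz'])⟩

lemma iInter_closure_compression_subset (hH : ¬ FiniteDimensional ℂ H) (A : Fin m → (H →L[ℂ] H)) :
    ⋂ (K : Submodule ℂ H) (Y : Kᗮ →ₗᵢ[ℂ] H) (_ : IsFiniteCodimIsometry K Y),
      closure (blockRange (κ := κ) ι (fun j => compression Y (A j)) ⊥) ⊆ cofiniteRange ι A := by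
  intro B hB K hK
  simp only [Set.mem_iInter] at hB
  obtain ⟨v, -, hv⟩ := exists_norm_eq_one_mem_orthogonal hH (⊥ : Submodule ℂ H)
  have hv0 : v ≠ 0 := fun h => by simp [h] at hv
  -- Adding `v` ensures dimension at least `1`, even for `K = ⊥`.
  let L := K ⊔ ℂ ∙ v
  have hL : IsFiniteCodimIsometry L (Lᗮ).subtypeₗᵢ := by
    constructor
    · rw [Nat.one_le_iff_ne_zero, Ne, Submodule.finrank_eq_zero]
      intro h
      have : v ∈ L := Submodule.mem_sup_right (Submodule.mem_span_singleton_self v)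
      rw [h] at this
      exact hv0 (by simpa using this)
    · have : LinearMap.range (Lᗮ).subtypeₗᵢ.toLinearMap = Lᗮ := by simp
      rw [this, Submodule.orthogonal_orthogonal]
      infer_instance
  refine closure_mono ?_ (hB L _ hL)
  rintro C ⟨x, -, hx⟩
  exact ⟨_, fun a i => Submodule.orthogonal_le le_sup_left (x a i).2,
    isSystem_compression_iff.1 hx⟩

end

lemma cofiniteRange_fin_eq {κ : Type*} [DecidableEq κ] [Fintype κ] (A : Fin m → (H →L[ℂ] H))
    {p : ℕ} (hp : 1 ≤ p) :
    cofiniteRange (κ := κ) (Fin p) A = cofiniteRange Unit A :=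
  (cofiniteRange_subset_of_injective (e := fun _ : Unit => (⟨0, hp⟩ : Fin p))
    (Function.injective_of_subsingleton _)).antisymm (cofiniteRange_unit_subset _ A)

lemma essQMatricialRange_eq_cofiniteRange (hH : ¬ FiniteDimensional ℂ H) (q : ℕ)
    (A : Fin m → (H →L[ℂ] H)) : essQMatricialRange q A = cofiniteRange Unit A := by
  simp only [essQMatricialRange, jointQMatricialRange_eq_blockRange]
  refine subset_antisymm (fun B hB => mem_cofiniteRange_of_finiteRank hH ?_)
    (Set.subset_iInter₂ fun F hF => cofiniteRange_subset_closure_add hF)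
  simpa only [Set.mem_iInter] using hB

lemma essMatricialRange_eq_cofiniteRange (hH : ¬ FiniteDimensional ℂ H) {p : ℕ} (hp : 1 ≤ p)
    (q : ℕ) (A : Fin m → (H →L[ℂ] H)) : essMatricialRange p q A = cofiniteRange Unit A := by
  refine subset_antisymm ?_ ?_
  · rw [← essQMatricialRange_eq_cofiniteRange hH]
    simp only [essMatricialRange, essQMatricialRange, jointMatricialRange_eq_blockRange,
      jointQMatricialRange_eq_blockRange]
    exact Set.iInter₂_mono fun F hF => closure_mono (blockRange_subset_of_injective
      (e := fun _ : Unit => (⟨0, hp⟩ : Fin p)) (Function.injective_of_subsingleton _))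
  · simp only [essMatricialRange, jointMatricialRange_eq_blockRange]
    rw [← cofiniteRange_fin_eq A hp]
    exact Set.subset_iInter₂ fun F hF => cofiniteRange_subset_closure_add hF

lemma smul_one_mem_cofiniteRange_of_essNumericalRange (hH : ¬ FiniteDimensional ℂ H) (q : ℕ)
    {A : Fin m → (H →L[ℂ] H)} {a : Fin m → ℂ} (ha : a ∈ essNumericalRange A) :
    (fun j => a j • (1 : Matrix (Fin q) (Fin q) ℂ)) ∈ cofiniteRange Unit A := by
  simp only [essNumericalRange, Set.mem_iInter] at ha
  exact smul_one_mem_cofiniteRange (mem_cofiniteRange_of_finiteRank hH fun F hF =>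
    mem_closure_blockRange_of_jointNumericalRange (ha F hF))

lemma cofiniteRange_subset_starCenters (q : ℕ) {r : ℕ} (hr : 1 ≤ r) (A : Fin m → (H →L[ℂ] H)) :
    cofiniteRange Unit A ⊆ starCenters (closure (jointMatricialRange r q A)) := by
  rw [jointMatricialRange_eq_blockRange, ← cofiniteRange_fin_eq A hr]
  exact fun B hB => ⟨hB ⊥ inferInstance, fun C hC s t hs ht hst =>
    cofiniteRange_smul_add_smul_mem hB hC hs ht hst⟩

lemma iInter_closure_jointMatricialRange_subset (q : ℕ) (A : Fin m → (H →L[ℂ] H)) :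
    ⋂ (r : ℕ) (_ : 1 ≤ r), closure (jointMatricialRange r q A) ⊆ cofiniteRange Unit A := by
  simp only [jointMatricialRange_eq_blockRange]
  exact iInter_closure_blockRange_subset A

end

end MatricialRange

theorem theorem4p1 {H : Type*} [NormedAddCommGroup H] [InnerProductSpace ℂ H] [CompleteSpace H]
    (hH : ¬ FiniteDimensional ℂ H) {m : ℕ} (A : Fin m → (H →L[ℂ] H))
    (hA : ∀ j, IsSelfAdjoint (A j)) (p₀ p q : ℕ) (hp₀ : 1 ≤ p₀) (hp : 1 ≤ p) (hq : 1 ≤ q) :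
    essMatricialRange p q A = essQMatricialRange q A ∧
    IsCompact (essMatricialRange p q A) ∧
    Convex ℝ (essMatricialRange p q A) ∧
    (∀ a ∈ essNumericalRange A,
      (fun j => a j • (1 : Matrix (Fin q) (Fin q) ℂ)) ∈ essMatricialRange p q A) ∧
    (∀ p' : ℕ, 1 ≤ p' → essMatricialRange p' q A = essMatricialRange p q A) ∧
    essMatricialRange p q A =
      ⋂ (r : ℕ) (_ : 1 ≤ r), starCenters (closure (jointMatricialRange r q A)) ∧
    essMatricialRange p q A =
      ⋂ (r : ℕ) (_ : 1 ≤ r), closure (jointMatricialRange r q A) ∧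
    essMatricialRange p q A =
      ⋂ (K : Submodule ℂ H) (Y : Kᗮ →ₗᵢ[ℂ] H) (_ : IsFiniteCodimIsometry K Y),
        closure (jointMatricialRange p₀ q (fun j => compression Y (A j))) := by
  have hess : ∀ r : ℕ, 1 ≤ r → essMatricialRange r q A = cofiniteRange Unit A :=
    fun r hr => essMatricialRange_eq_cofiniteRange hH hr q A
  have hstar : cofiniteRange Unit A ⊆
      ⋂ (r : ℕ) (_ : 1 ≤ r), starCenters (closure (jointMatricialRange r q A)) :=
    Set.subset_iInter₂ fun r hr => cofiniteRange_subset_starCenters q hr A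
  have hstar' : ⋂ (r : ℕ) (_ : 1 ≤ r), starCenters (closure (jointMatricialRange r q A)) ⊆
      ⋂ (r : ℕ) (_ : 1 ≤ r), closure (jointMatricialRange r q A) :=
    Set.iInter₂_mono fun r hr => fun B hB => hB.1
  have hr := iInter_closure_jointMatricialRange_subset q A
  rw [hess p hp]
  refine ⟨(essQMatricialRange_eq_cofiniteRange hH q A).symm, isCompact_cofiniteRange A,
    convex_cofiniteRange A, fun a ha => smul_one_mem_cofiniteRange_of_essNumericalRange hH q ha,
    hess, hstar.antisymm (hstar'.trans hr), (hstar.trans hstar').antisymm hr, ?_⟩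
  simp only [jointMatricialRange_eq_blockRange]
  -- Amplification lets `p₀` differ from `p`.
  rw [← cofiniteRange_fin_eq A hp₀]
  refine subset_antisymm (Set.subset_iInter fun K => Set.subset_iInter₂ fun Y hY => ?_)
    (iInter_closure_compression_subset hH A)
  have := hY.2
  exact cofiniteRange_subset_closure_compression A Y
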